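/- Let $d\ge 2$ and fix inner products $\langle\cdot,\cdot\rangle_1,\dots,\langle\cdot,\cdot\rangle_d$ on $\mathbb{R}^2$. For $r\ge 1$ let $W_r\subseteq(\mathbb{R}^2)^{\otimes d}$ be the Zariski closure of the set of all tensors $\sum_{i=1}^r x^{(i)}_1\otimes\cdots\otimes x^{(i)}_d$ (zero summands allowed) such that for all $i\neq j$ there are two distinct indices $k_1\ne k_2$ with $\langle x^{(i)}_{k_1},x^{(j)}_{k_1}\rangle_{k_1}=0$ and $\langle x^{(i)}_{k_2},x^{(j)}_{k_2}\rangle_{k_2}=0$. Such an expression with all $r$ summands nonzero is a two-orthogonal decomposition of length $r$; it is basis-aligned if for all $k,i,j$ the vectors $x^{(i)}_k$ and $x^{(j)}_k$ are collinear or orthogonal with respect to $\langle\cdot,\cdot\rangle_k$. Let $A\subseteq(\mathbb{R}^2)^{\otimes d}$ be the set of tensors that have a basis-aligned two-orthogonal decomposition of length $2^{d-1}$, and let $D=W_{2^{d-1}}\setminus W_{2^{d-1}-1}$. If $D$ is nonempty, then up to Zariski closure it consists of basis-aligned tensors, that is, $\overline{D\cap A}=\overline{D}=\overline{A}$, and $\dim\overline{D}=2^{d-1}+d$.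 Here the overline denotes Zariski closure in the real vector space $(\mathbb{R}^2)^{\otimes d}$, and the dimension is the Krull dimension of the coordinate ring $\mathbb{R}[t_{i_1\cdots i_d}]/I(\overline{D})$. -/

import Mathlib

open scoped TensorProduct

noncomputable section

/-- The space `(ℝ²)^{⊗ d}` of binary tensors of order `d`. -/
abbrev BinaryTensor (d : ℕ) : Type := ⨂[ℝ] _ : Fin d, (Fin 2 → ℝ)

/-- The basis `e_{i₁} ⊗ ⋯ ⊗ e_{i_d}` of `(ℝ²)^{⊗ d}` built from the standard basis of `ℝ²`. -/
def BinaryTensor.stdBasis (d : ℕ) : Module.Basis (Fin d → Fin 2) ℝ (BinaryTensor d) :=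
  Basis.piTensorProduct fun _ : Fin d => Pi.basisFun ℝ (Fin 2)

/-- The coordinates `t_{i₁ ⋯ i_d}` of a binary tensor. -/
def BinaryTensor.coords {d : ℕ} (T : BinaryTensor d) : (Fin d → Fin 2) → ℝ :=
  fun i => (BinaryTensor.stdBasis d).repr T i

/-- The ideal of all polynomials in the `2 ^ d` coordinates that vanish on `S`. -/
def tensorIdeal {d : ℕ} (S : Set (BinaryTensor d)) :
    Ideal (MvPolynomial (Fin d → Fin 2) ℝ) :=
  MvPolynomial.vanishingIdeal ℝ (BinaryTensor.coords '' S)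

/-- The (real) Zariski closure of a set of binary tensors. -/
def zariskiClosure {d : ℕ} (S : Set (BinaryTensor d)) : Set (BinaryTensor d) :=
  {T | T.coords ∈ MvPolynomial.zeroLocus ℝ (tensorIdeal S)}

/-- The dimension of (the Zariski closure of) a set of binary tensors: the Krull dimension of its
coordinate ring. -/
def varietyDim {d : ℕ} (S : Set (BinaryTensor d)) : WithBot ℕ∞ :=
  ringKrullDim (MvPolynomial (Fin d → Fin 2) ℝ ⧸ tensorIdeal S)

/-- The rank-one terms `x i 0 ⊗ ⋯ ⊗ x i (d - 1)`, `i : Fin r`, are pairwise orthogonal in at least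
two factors, where orthogonality in the `k`-th factor is with respect to `B k`. -/
def PairwiseTwoOrthogonal {d r : ℕ} (B : Fin d → LinearMap.BilinForm ℝ (Fin 2 → ℝ))
    (x : Fin r → Fin d → Fin 2 → ℝ) : Prop :=
  ∀ i j, i ≠ j → ∃ k₁ k₂, k₁ ≠ k₂ ∧ B k₁ (x i k₁) (x j k₁) = 0 ∧ B k₂ (x i k₂) (x j k₂) = 0

/-- `W_r`: the Zariski closure of the set of tensors with a two-orthogonal decomposition of length
at most `r` (zero summands are allowed). -/
def twoOrthogonalVariety {d : ℕ} (B : Fin d → LinearMap.BilinForm ℝ (Fin 2 → ℝ)) (r : ℕ) :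
    Set (BinaryTensor d) :=
  zariskiClosure {T | ∃ x : Fin r → Fin d → Fin 2 → ℝ,
    PairwiseTwoOrthogonal B x ∧ T = ∑ i, PiTensorProduct.tprod ℝ (x i)}

/-- `T = ∑ i, x i 0 ⊗ ⋯ ⊗ x i (d - 1)` is a two-orthogonal decomposition of length `r`: all
summands are nonzero, and they are pairwise orthogonal in at least two factors. -/
structure IsTwoOrthogonalDecomposition {d r : ℕ}
    (B : Fin d → LinearMap.BilinForm ℝ (Fin 2 → ℝ)) (T : BinaryTensor d)
    (x : Fin r → Fin d → Fin 2 → ℝ) : Prop where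
  eq_sum : T = ∑ i, PiTensorProduct.tprod ℝ (x i)
  summand_ne_zero : ∀ i, PiTensorProduct.tprod ℝ (x i) ≠ 0
  pairwise : PairwiseTwoOrthogonal B x

/-- A two-orthogonal decomposition is basis-aligned if in each factor any two of its vectors are
collinear (they lie on one line through the origin) or orthogonal. -/
structure IsBasisAlignedDecomposition {d r : ℕ}
    (B : Fin d → LinearMap.BilinForm ℝ (Fin 2 → ℝ)) (T : BinaryTensor d)
    (x : Fin r → Fin d → Fin 2 → ℝ) : Prop
    extends IsTwoOrthogonalDecomposition B T x where
  aligned : ∀ k i j, Collinear ℝ ({0, x i k, x j k} : Set (Fin 2 → ℝ)) ∨ B k (x i k) (x j k) = 0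

/-- The tensors that have a basis-aligned two-orthogonal decomposition with exactly `r`
summands. -/
def basisAlignedTensors {d : ℕ} (B : Fin d → LinearMap.BilinForm ℝ (Fin 2 → ℝ)) (r : ℕ) :
    Set (BinaryTensor d) :=
  {T | ∃ x : Fin r → Fin d → Fin 2 → ℝ, IsBasisAlignedDecomposition B T x}

end

/-! Put r = 2^(d-1). Label the lines of each plane by ℤ/2 so that orthogonal lines get different
labels. A two-orthogonal family of r nonzero terms then becomes a binary code of length d with
minimum distance two, and a code of that size is the set of all words of one parity
(`parity_eq_of_two_ne`). The labels of a line and its perpendicular may be flipped together in one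
factor. If two vectors there were neither proportional nor orthogonal, such a flip would change the
parity of one word and not of the other. Hence every such family is aligned
(`PairwiseTwoOrthogonal.isAligned`). So the tensors in A are sums over even words in rotated
orthogonal bases. The coefficients and slopes parametrize them by polynomials, and I(A) is the
kernel of the comorphism, hence prime. A Jacobian at e₀ ⊗ ⋯ ⊗ e₀ shows that the 2^(d-1) + d
parameters are all effective. A length-r sum outside A has a zero summand, so it lies in W_{r-1};
thus D lies in the closure of A. If D is nonempty, A is not contained in W_{r-1}, and primality of
I(A) makes D ∩ A dense in A. -/

/-! ### Krull dimension and transcendence degree -/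

/-- Incomparability: strict inclusions of primes stay strict after contraction. -/
theorem ringKrullDim_le_of_isIntegral {R S : Type*} [CommRing R] [CommRing S] [Algebra R S]
    [Algebra.IsIntegral R S] : ringKrullDim S ≤ ringKrullDim R := by
  refine Order.krullDim_le_of_strictMono (PrimeSpectrum.comap (algebraMap R S)) ?_
  intro p q hpq
  obtain ⟨hle, x, hxq, hxp⟩ := SetLike.lt_iff_le_and_exists.1 (show p.asIdeal < q.asIdeal from hpq)
  exact Ideal.comap_lt_comap_of_integral_mem_sdiff hle ⟨hxq, hxp⟩ (Algebra.IsIntegral.isIntegral x)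

/-- Lying over starts the chain and going up extends it; tracking the last prime is what carries the
induction. -/
theorem exists_ltSeries_over_of_isIntegral {R S : Type*} [CommRing R] [CommRing S] [Algebra R S]
    [Algebra.IsIntegral R S] (hinj : Function.Injective (algebraMap R S)) (n : ℕ) :
    ∀ l : LTSeries (PrimeSpectrum R), l.length = n → ∃ l' : LTSeries (PrimeSpectrum S),
      l'.length = n ∧ PrimeSpectrum.comap (algebraMap R S) l'.last = l.last := by
  induction n with
  | zero =>
    intro l _
    obtain ⟨Q, -, hQp, hQ⟩ := Ideal.exists_ideal_over_prime_of_isIntegral (S := S) l.last.asIdeal ⊥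
      (by rw [← RingHom.ker_eq_comap_bot, (RingHom.injective_iff_ker_eq_bot _).1 hinj]
          exact bot_le)
    exact ⟨RelSeries.singleton _ ⟨Q, hQp⟩, rfl, PrimeSpectrum.ext hQ⟩
  | succ n ih =>
    intro l hl
    obtain ⟨l', hl', hlast⟩ := ih l.eraseLast (by simp [hl])
    have hlt : l.eraseLast.last < l.last := l.eraseLast_last_rel_last (by omega)
    obtain ⟨Q, hle, hQp, hQ⟩ := Ideal.exists_ideal_over_prime_of_isIntegral (S := S)
      l.last.asIdeal l'.last.asIdeal
      (by
        have h := congrArg PrimeSpectrum.asIdeal hlast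
        rw [PrimeSpectrum.comap_asIdeal] at h
        rw [h]
        exact hlt.le)
    have hcomap : PrimeSpectrum.comap (algebraMap R S) ⟨Q, hQp⟩ = l.last := PrimeSpectrum.ext hQ
    have hlt' : l'.last < ⟨Q, hQp⟩ := by
      refine lt_of_le_of_ne hle fun h => hlt.ne ?_
      rw [← hlast, h, hcomap]
    exact ⟨l'.snoc ⟨Q, hQp⟩ hlt', by simp [hl'], by simpa using hcomap⟩

theorem ringKrullDim_eq_of_isIntegral {R S : Type*} [CommRing R] [CommRing S] [Algebra R S]
    [Algebra.IsIntegral R S] (hinj : Function.Injective (algebraMap R S)) :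
    ringKrullDim S = ringKrullDim R := by
  refine le_antisymm ringKrullDim_le_of_isIntegral (iSup_le fun l => ?_)
  obtain ⟨l', hl', -⟩ := exists_ltSeries_over_of_isIntegral hinj l.length l rfl
  rw [← hl']
  exact le_iSup (fun l : LTSeries (PrimeSpectrum S) => (l.length : WithBot ℕ∞)) l'

/-- The Krull dimension of a finitely generated domain over a field is its transcendence degree. -/
theorem ringKrullDim_eq_of_trdeg_eq {k S : Type} [Field k] [CommRing S] [IsDomain S] [Algebra k S]
    [Algebra.FiniteType k S] {n : ℕ} (hn : Algebra.trdeg k S = n) : ringKrullDim S = n := by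
  -- Noether normalization: both invariants equal the number `s` of variables.
  obtain ⟨s, g, hinj, hint⟩ := exists_integral_inj_algHom_of_fg k S
  let : Algebra (MvPolynomial (Fin s) k) S := g.toRingHom.toAlgebra
  have : IsScalarTower k (MvPolynomial (Fin s) k) S := IsScalarTower.of_algHom g
  have : Algebra.IsIntegral (MvPolynomial (Fin s) k) S := ⟨hint⟩
  have hinj' : Function.Injective (algebraMap (MvPolynomial (Fin s) k) S) := hinj
  have : FaithfulSMul (MvPolynomial (Fin s) k) S := (faithfulSMul_iff_algebraMap_injective _ _).2 hinj'
  have htr := trdeg_add_eq k (MvPolynomial (Fin s) k) (A := S)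
  rw [trdeg_eq_zero (R := MvPolynomial (Fin s) k), MvPolynomial.trdeg_of_isDomain, hn] at htr
  have hsn : s = n := by
    have : (s : Cardinal.{0}) = n := by simpa using htr
    exact_mod_cast this
  rw [ringKrullDim_eq_of_isIntegral hinj', MvPolynomial.ringKrullDim_of_isNoetherianRing,
    ringKrullDim_eq_zero_of_field]
  simp [hsn]

/-! ### The Jacobian criterion -/

namespace MvPolynomial

theorem pderiv_aeval {R σ ι : Type*} [CommRing R] [Fintype ι] (g : ι → MvPolynomial σ R) (i : σ)
    (P : MvPolynomial ι R) :
    pderiv i (aeval g P) = ∑ j, aeval g (pderiv j P) * pderiv i (g j) := by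
  classical
  induction P using MvPolynomial.induction_on with
  | C a => simp [algebraMap_eq]
  | add p q hp hq => simp only [map_add, hp, hq, add_mul, Finset.sum_add_distrib]
  | mul_X p l hp =>
    simp only [map_mul, aeval_X, pderiv_mul, hp, map_add, add_mul, Finset.sum_add_distrib,
      pderiv_X, Finset.sum_mul]
    congr 1
    · exact Finset.sum_congr rfl fun _ _ => by ring
    · rw [Finset.sum_eq_single l]
      · simp
      · intro b _ hb
        simp [hb.symm]
      · simp

theorem totalDegree_pderiv_lt {R σ : Type*} [CommRing R] (P : MvPolynomial σ R) (j : σ)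
    (hP : P.totalDegree ≠ 0) : (pderiv j P).totalDegree < P.totalDegree := by
  classical
  rw [totalDegree, Finset.sup_lt_iff (by simpa using Nat.pos_of_ne_zero hP)]
  intro m hm
  have hne : coeff (m + Finsupp.single j 1) P ≠ 0 := by
    intro h
    rw [mem_support_iff, coeff_pderiv, h, zero_mul] at hm
    exact hm rfl
  have := le_totalDegree (mem_support_iff.2 hne)
  rw [Finsupp.sum_add_index' (by simp) (by simp)] at this
  simp at this
  simp
  omega

/-- The Jacobian criterion in characteristic zero: polynomials whose Jacobian matrix (for some
choice of variables) is nonsingular at some point are algebraically independent. -/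
theorem algebraicIndependent_of_jacobian {k σ ι : Type*} [Field k] [CharZero k] [Fintype ι]
    [DecidableEq ι] (g : ι → MvPolynomial σ k) (e : ι → σ) (x : σ → k)
    (hdet : (Matrix.of fun i j => eval x (pderiv (e i) (g j))).det ≠ 0) :
    AlgebraicIndependent k g := by
  rw [algebraicIndependent_iff]
  intro P
  induction hN : P.totalDegree using Nat.strong_induction_on generalizing P with
  | _ N ih =>
    intro hP
    have hconst : P.totalDegree = 0 := by
      by_contra hdeg
      -- By the chain rule, differentiating the relation P(g) = 0 puts the vector of (∂ⱼP)(g) in the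
      -- kernel of the Jacobian matrix. So each ∂ⱼP is a relation of smaller degree, and it vanishes
      -- by induction.
      have hmul : Matrix.mulVec (Matrix.of fun i j => pderiv (e i) (g j))
          (fun j => aeval g (pderiv j P)) = 0 := by
        funext i
        have := pderiv_aeval g (e i) P
        rw [hP, map_zero] at this
        simp only [Matrix.mulVec, dotProduct, Matrix.of_apply, Pi.zero_apply]
        rw [this]
        exact Finset.sum_congr rfl fun _ _ => mul_comm _ _
      have hdet' : (Matrix.of fun i j => pderiv (e i) (g j)).det ≠ 0 := by
        intro h
        apply hdet
        have := congrArg (eval x) h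
        rw [RingHom.map_det, map_zero] at this
        exact this
      have hz := Matrix.eq_zero_of_mulVec_eq_zero hdet' hmul
      have hder : ∀ j, pderiv j P = 0 := fun j =>
        ih _ (hN ▸ totalDegree_pderiv_lt P j hdeg) _ rfl (congrFun hz j)
      apply hdeg
      rw [totalDegree_eq_zero_iff]
      intro m hm j
      by_contra hj
      have hco := coeff_pderiv (i := j) P (m - Finsupp.single j 1)
      have hle : Finsupp.single j 1 ≤ m := by
        rw [Finsupp.single_le_iff]
        omega
      rw [hder j, coeff_zero, tsub_add_cancel_of_le hle] at hco
      rcases mul_eq_zero.1 hco.symm with h | h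
      · exact (mem_support_iff.1 hm) h
      · exact Nat.cast_add_one_ne_zero _ h
    rw [totalDegree_eq_zero_iff_eq_C] at hconst
    rw [hconst, aeval_C, algebraMap_eq, C_eq_zero] at hP
    rw [hconst, hP, C_0]

end MvPolynomial

/-! ### Binary codes of minimum distance two -/

/-- The binary words of length `d` with an even number of ones. -/
abbrev EvenWord (d : ℕ) : Type := {v : Fin d → ZMod 2 // ∑ k, v k = 0}

theorem card_evenWord {d : ℕ} (hd : 1 ≤ d) : Fintype.card (EvenWord d) = 2 ^ (d - 1) := by
  obtain ⟨n, rfl⟩ : ∃ n, d = n + 1 := ⟨d - 1, by omega⟩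
  let φ : EvenWord (n + 1) ≃ (Fin n → ZMod 2) :=
    { toFun := fun v => Fin.tail v.1
      invFun := fun u => ⟨Fin.cons (-∑ k, u k) u, by
        simp [Fin.sum_univ_succ, CharTwo.add_self_eq_zero]⟩
      left_inv := by
        rintro ⟨v, hv⟩
        rw [Fin.sum_univ_succ, add_eq_zero_iff_eq_neg] at hv
        ext k
        refine Fin.cases ?_ (fun k => ?_) k
        · simp [hv, Fin.tail]
        · simp [Fin.tail]
      right_inv := fun u => by simp }
  rw [Fintype.card_congr φ]
  simp [ZMod.card]

/-- Changing exactly one letter would change the parity. -/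
theorem EvenWord.exists_two_ne {d : ℕ} {v w : EvenWord d} (h : v ≠ w) :
    ∃ k₁ k₂, k₁ ≠ k₂ ∧ v.1 k₁ ≠ w.1 k₁ ∧ v.1 k₂ ≠ w.1 k₂ := by
  obtain ⟨k₁, hk₁⟩ := Function.ne_iff.1 (fun hvw => h (Subtype.ext hvw))
  by_contra! hcon
  have hoff : ∀ k ∈ Finset.univ.erase k₁, v.1 k = w.1 k := fun k hk =>
    hcon k₁ k (Finset.ne_of_mem_erase hk).symm hk₁
  have hs := v.2.trans w.2.symm
  rw [← Finset.add_sum_erase _ _ (Finset.mem_univ k₁),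
    ← Finset.add_sum_erase _ w.1 (Finset.mem_univ k₁), Finset.sum_congr rfl hoff] at hs
  exact hk₁ (add_right_cancel hs)

/-- All words of a binary code of length `d`, size `2 ^ (d - 1)` and minimum distance at least two
have the same parity. -/
theorem parity_eq_of_two_ne {d : ℕ} {ι : Type*} [Fintype ι]
    (hcard : Fintype.card ι = 2 ^ (d - 1)) (u : ι → Fin d → ZMod 2)
    (hu : ∀ i j, i ≠ j → ∃ k₁ k₂, k₁ ≠ k₂ ∧ u i k₁ ≠ u j k₁ ∧ u i k₂ ≠ u j k₂) (i j : ι) :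
    ∑ k, u i k = ∑ k, u j k := by
  classical
  have hinj : ∀ k i j, (∀ l, l ≠ k → u i l = u j l) → i = j := by
    intro k i j h
    by_contra hij
    obtain ⟨k₁, k₂, hne, h₁, h₂⟩ := hu i j hij
    by_cases hk : k₁ = k
    · exact h₂ (h k₂ (hk ▸ hne.symm))
    · exact h₁ (h k₁ hk)
  -- Deleting the k-th letter is injective on the code, hence bijective by cardinality.
  have hsurj : ∀ (k : Fin d) (v : Fin d → ZMod 2), ∃ i, ∀ l, l ≠ k → u i l = v l := by
    intro k v
    let f : ι → ({l : Fin d // l ≠ k} → ZMod 2) := fun i l => u i l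
    have hf : Function.Bijective f := by
      rw [Fintype.bijective_iff_injective_and_card]
      refine ⟨fun i j hij => hinj k i j fun l hl => congrFun hij ⟨l, hl⟩, ?_⟩
      simp [hcard, ZMod.card, Fintype.card_subtype_compl]
    obtain ⟨i, hi⟩ := hf.2 fun l => v l
    exact ⟨i, fun l hl => congrFun hi ⟨l, hl⟩⟩
  -- Every edge of the cube has exactly one endpoint in the code, so the indicator `χ` changes at
  -- each flip of a letter; it is therefore the parity up to a constant.
  let χ : (Fin d → ZMod 2) → ZMod 2 := fun v => if v ∈ Set.range u then 1 else 0
  have hflip : ∀ v w k, (∀ l, l ≠ k → v l = w l) → v k ≠ w k → χ v = χ w + 1 := by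
    intro v w k hvw hk
    have hex : v ∈ Set.range u ∨ w ∈ Set.range u := by
      obtain ⟨i, hi⟩ := hsurj k v
      have hz : ∀ a b c : ZMod 2, b ≠ c → a = b ∨ a = c := by decide
      rcases hz (u i k) _ _ hk with h | h
      · refine Or.inl ⟨i, funext fun l => ?_⟩
        by_cases hl : l = k
        · rw [hl, h]
        · exact hi l hl
      · refine Or.inr ⟨i, funext fun l => ?_⟩
        by_cases hl : l = k
        · rw [hl, h]
        · rw [hi l hl, hvw l hl]
    have hnot : ¬ (v ∈ Set.range u ∧ w ∈ Set.range u) := by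
      rintro ⟨⟨i, rfl⟩, ⟨j, rfl⟩⟩
      exact hk (by rw [hinj k i j hvw])
    by_cases hv : v ∈ Set.range u
    · have hw : w ∉ Set.range u := fun hw => hnot ⟨hv, hw⟩
      simp only [χ, if_pos hv, if_neg hw]; decide
    · have hw : w ∈ Set.range u := hex.resolve_left hv
      simp only [χ, if_neg hv, if_pos hw]; decide
  have hχ : ∀ (v : Fin d → ZMod 2) (s : Finset (Fin d)),
      χ (fun k => if k ∈ s then v k else 0) = χ 0 + ∑ k ∈ s, v k := by
    intro v s
    induction s using Finset.induction_on with
    | empty => simp; rfl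
    | insert a s ha ih =>
      rw [Finset.sum_insert ha]
      have hz : ∀ b : ZMod 2, b = 0 ∨ b = 1 := by decide
      rcases hz (v a) with h | h
      · rw [h, zero_add, ← ih]
        congr 1
        funext k
        by_cases hk : k = a
        · simp [hk, ha, h]
        · simp [hk]
      · rw [hflip _ (fun k => if k ∈ s then v k else 0) a, ih, h]
        · ring
        · intro l hl
          simp [hl]
        · simp [ha, h]
  have hmem : ∀ i, χ (u i) = 1 := fun i => if_pos ⟨i, rfl⟩
  have hfull : ∀ v, χ v = χ 0 + ∑ k, v k := fun v => by simpa using hχ v Finset.univ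
  exact add_left_cancel ((hfull (u i)).symm.trans (((hmem i).trans (hmem j).symm).trans
    (hfull (u j))))

/-! ### Orthogonality and alignment in the plane -/

noncomputable section

/-- `e` is an orthonormal basis of the plane with respect to `B`. -/
structure IsOrthonormalFrame (B : LinearMap.BilinForm ℝ (Fin 2 → ℝ)) (e : ZMod 2 → Fin 2 → ℝ) :
    Prop where
  apply_eq : ∀ s t, B (e s) (e t) = if s = t then 1 else 0
  expand : ∀ x, x = B (e 0) x • e 0 + B (e 1) x • e 1

theorem exists_isOrthonormalFrame (B : LinearMap.BilinForm ℝ (Fin 2 → ℝ)) (hsymm : B.IsSymm)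
    (hpos : ∀ x, x ≠ 0 → 0 < B x x) : ∃ e, IsOrthonormalFrame B e := by
  obtain ⟨v, hv⟩ : ∃ v : Module.Basis (ZMod 2) ℝ (Fin 2 → ℝ), ∀ s t, s ≠ t → B (v s) (v t) = 0 := by
    obtain ⟨v, hv⟩ := LinearMap.BilinForm.exists_orthogonal_basis
      (LinearMap.BilinForm.isSymm_iff.1 hsymm)
    let c : Fin (Module.finrank ℝ (Fin 2 → ℝ)) ≃ ZMod 2 :=
      finCongr (by simp : Module.finrank ℝ (Fin 2 → ℝ) = 2)
    refine ⟨v.reindex c, fun s t hst => ?_⟩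
    rw [Module.Basis.reindex_apply, Module.Basis.reindex_apply]
    exact hv (fun h => hst (c.symm.injective h))
  have hp : ∀ s, 0 < B (v s) (v s) := fun s => hpos _ (v.ne_zero s)
  have happ : ∀ s t, B ((√(B (v s) (v s)))⁻¹ • v s) ((√(B (v t) (v t)))⁻¹ • v t) =
      if s = t then 1 else 0 := by
    intro s t
    split_ifs with h
    · subst h
      have h1 := Real.mul_self_sqrt (hp s).le
      have h2 : √(B (v s) (v s)) ≠ 0 := (Real.sqrt_pos.2 (hp s)).ne'
      simp only [map_smul, LinearMap.smul_apply, smul_eq_mul]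
      field_simp
      rw [sq, h1]
    · simp [hv s t h]
  obtain ⟨e, happ, hspan⟩ : ∃ e : ZMod 2 → Fin 2 → ℝ,
      (∀ s t, B (e s) (e t) = if s = t then 1 else 0) ∧
        ∀ x, ∃ a b : ℝ, x = a • e 0 + b • e 1 := by
    refine ⟨fun s => (√(B (v s) (v s)))⁻¹ • v s, happ, fun x => ?_⟩
    refine ⟨v.repr x 0 * √(B (v 0) (v 0)), v.repr x 1 * √(B (v 1) (v 1)), ?_⟩
    have h0 : √(B (v 0) (v 0)) ≠ 0 := (Real.sqrt_pos.2 (hp 0)).ne'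
    have h1 : √(B (v 1) (v 1)) ≠ 0 := (Real.sqrt_pos.2 (hp 1)).ne'
    rw [smul_smul, smul_smul, mul_assoc, mul_assoc, mul_inv_cancel₀ h0, mul_inv_cancel₀ h1,
      mul_one, mul_one]
    have := (v.sum_repr x).symm
    rwa [show (∑ i : ZMod 2, v.repr x i • v i) = v.repr x 0 • v 0 + v.repr x 1 • v 1 from
      Fin.sum_univ_two (fun i : Fin 2 => v.repr x i • v i)] at this
  refine ⟨e, happ, fun x => ?_⟩
  obtain ⟨a, b, rfl⟩ := hspan x
  simp [happ]

namespace IsOrthonormalFrame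

variable {B : LinearMap.BilinForm ℝ (Fin 2 → ℝ)} {e : ZMod 2 → Fin 2 → ℝ}

theorem apply_comb (he : IsOrthonormalFrame B e) (p q p' q' : ℝ) :
    B (p • e 0 + q • e 1) (p' • e 0 + q' • e 1) = p * p' + q * q' := by
  simp only [map_add, map_smul, LinearMap.add_apply, LinearMap.smul_apply, he.apply_eq, smul_eq_mul]
  simp
  ring

theorem apply_eq_coords (he : IsOrthonormalFrame B e) (x y : Fin 2 → ℝ) :
    B x y = B (e 0) x * B (e 0) y + B (e 1) x * B (e 1) y := by
  conv_lhs => rw [he.expand x, he.expand y]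
  exact he.apply_comb _ _ _ _

/-- The perpendicular of (p, q) ≠ 0 is the line through its quarter turn (-q, p). -/
theorem exists_eq_of_orthogonal (he : IsOrthonormalFrame B e) {x y : Fin 2 → ℝ} (hx : x ≠ 0)
    (h : B x y = 0) : ∃ c, B (e 0) y = -c * B (e 1) x ∧ B (e 1) y = c * B (e 0) x := by
  rw [he.apply_eq_coords] at h
  set p := B (e 0) x
  set q := B (e 1) x
  have hN : p ^ 2 + q ^ 2 ≠ 0 := by
    intro h0
    have hp : p = 0 := by nlinarith [sq_nonneg p, sq_nonneg q]
    have hq : q = 0 := by nlinarith [sq_nonneg p, sq_nonneg q]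
    apply hx
    rw [he.expand x]
    change p • _ + q • _ = _
    simp [hp, hq]
  refine ⟨(p * B (e 1) y - q * B (e 0) y) / (p ^ 2 + q ^ 2), ?_, ?_⟩
  · field_simp
    linear_combination p * h
  · field_simp
    linear_combination q * h

end IsOrthonormalFrame

open Classical in
/-- A label of the line through `x` in the plane with frame `e`; orthogonal lines receive distinct
labels. -/
def lineLabel (B : LinearMap.BilinForm ℝ (Fin 2 → ℝ)) (e : ZMod 2 → Fin 2 → ℝ) (x : Fin 2 → ℝ) :
    ZMod 2 :=
  if 0 < B (e 0) x * B (e 1) x ∨ B (e 1) x = 0 then 0 else 1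

/-- A quarter turn reverses the sign of pq; when pq = 0 it exchanges the two axes, which are
labelled 0 and 1. -/
theorem lineLabel_of_orthogonal {B : LinearMap.BilinForm ℝ (Fin 2 → ℝ)} {e : ZMod 2 → Fin 2 → ℝ}
    (he : IsOrthonormalFrame B e) {x y : Fin 2 → ℝ} (hx : x ≠ 0) (hy : y ≠ 0) (h : B x y = 0) :
    lineLabel B e x = lineLabel B e y + 1 := by
  obtain ⟨c, h0, h1⟩ := he.exists_eq_of_orthogonal hx h
  have hc : c ≠ 0 := by
    rintro rfl
    apply hy
    rw [he.expand y, h0, h1]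
    simp
  have hxpq : ¬ (B (e 0) x = 0 ∧ B (e 1) x = 0) := by
    rintro ⟨h0, h1⟩
    apply hx
    rw [he.expand x, h0, h1]
    simp
  unfold lineLabel
  rw [h0, h1]
  set p := B (e 0) x
  set q := B (e 1) x
  have hc2 : 0 < c ^ 2 := by positivity
  by_cases hx0 : 0 < p * q ∨ q = 0
  · have : ¬ (0 < -c * q * (c * p) ∨ c * p = 0) := by
      rintro (h | h)
      · have : 0 < c ^ 2 * -(p * q) := by linarith
        have := pos_of_mul_pos_right this hc2.le
        rcases hx0 with h' | h'
        · linarith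
        · simp [h'] at this
      · have hp : p = 0 := (mul_eq_zero.1 h).resolve_left hc
        rcases hx0 with h' | h'
        · simp [hp] at h'
        · exact hxpq ⟨hp, h'⟩
    rw [if_pos hx0, if_neg this]; decide
  · have : 0 < -c * q * (c * p) ∨ c * p = 0 := by
      push Not at hx0
      rcases hx0.1.lt_or_eq with h' | h'
      · left
        have : 0 < c ^ 2 * -(p * q) := mul_pos hc2 (by linarith)
        linarith
      · right
        simp [(mul_eq_zero.1 h').resolve_right hx0.2]
    rw [if_neg hx0, if_pos this]; decide

/-- Two vectors of the plane that are proportional or orthogonal. -/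
def IsAligned (B : LinearMap.BilinForm ℝ (Fin 2 → ℝ)) (x y : Fin 2 → ℝ) : Prop :=
  (∃ r : ℝ, y = r • x) ∨ B x y = 0

/-- Two successive quarter turns return to the original line. -/
theorem IsAligned.of_orthogonal {B : LinearMap.BilinForm ℝ (Fin 2 → ℝ)} {e : ZMod 2 → Fin 2 → ℝ}
    (he : IsOrthonormalFrame B e) {x y z : Fin 2 → ℝ} (hx : x ≠ 0) (hy : y ≠ 0) (h : B y z = 0)
    (hxy : IsAligned B x y) : IsAligned B x z := by
  rcases hxy with ⟨r, rfl⟩ | hxy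
  · have hr : r ≠ 0 := by rintro rfl; simp at hy
    right
    simpa [hr] using h
  · obtain ⟨c, h0, h1⟩ := he.exists_eq_of_orthogonal hx hxy
    obtain ⟨c', h0', h1'⟩ := he.exists_eq_of_orthogonal hy h
    left
    refine ⟨-c' * c, ?_⟩
    rw [he.expand z, h0', h1', h0, h1]
    conv_rhs => rw [he.expand x]
    module

/-- In a pairwise two-orthogonal family of maximal size `2 ^ (d - 1)`, any two vectors in the same
factor are proportional or orthogonal. -/
theorem PairwiseTwoOrthogonal.isAligned {d r : ℕ} (hr : r = 2 ^ (d - 1))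
    {B : Fin d → LinearMap.BilinForm ℝ (Fin 2 → ℝ)} (hsymm : ∀ k, (B k).IsSymm)
    {e : Fin d → ZMod 2 → Fin 2 → ℝ}
    (he : ∀ k, IsOrthonormalFrame (B k) (e k)) {x : Fin r → Fin d → Fin 2 → ℝ}
    (hx : ∀ i k, x i k ≠ 0) (h : PairwiseTwoOrthogonal B x) (k : Fin d) (i j : Fin r) :
    IsAligned (B k) (x i k) (x j k) := by
  classical
  by_contra hcon
  -- A shift `δ` that agrees on orthogonal pairs preserves the differences between labels, so the
  -- shifted words still form a code.
  have hpar : ∀ δ : Fin r → Fin d → ZMod 2,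
      (∀ l i j, B l (x i l) (x j l) = 0 → δ i l = δ j l) →
      ∑ l, (lineLabel (B l) (e l) (x i l) + δ i l) =
        ∑ l, (lineLabel (B l) (e l) (x j l) + δ j l) := by
    intro δ hδ
    refine parity_eq_of_two_ne (by simp [hr])
      (fun i l => lineLabel (B l) (e l) (x i l) + δ i l) ?_ i j
    intro i j hij
    obtain ⟨k₁, k₂, hne, h₁, h₂⟩ := h i j hij
    have key : ∀ l, B l (x i l) (x j l) = 0 →
        lineLabel (B l) (e l) (x i l) + δ i l ≠ lineLabel (B l) (e l) (x j l) + δ j l := by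
      intro l hl
      rw [hδ l i j hl, lineLabel_of_orthogonal (he l) (hx i l) (hx j l) hl]
      have : ∀ a b : ZMod 2, a + 1 + b ≠ a + b := by decide
      exact this _ _
    exact ⟨k₁, k₂, hne, key _ h₁, key _ h₂⟩
  have h0 := hpar (fun _ _ => 0) (by simp)
  -- This shift flips the k-th label of exactly the vectors aligned with `x i k`: word i changes
  -- parity, word j does not.
  have h1 := hpar (fun a l => if l = k ∧ IsAligned (B k) (x i k) (x a k) then 1 else 0) (by
    intro l a b hab
    by_cases hl : l = k
    · subst hl
      have : IsAligned (B l) (x i l) (x a l) ↔ IsAligned (B l) (x i l) (x b l) :=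
        ⟨.of_orthogonal (he l) (hx i l) (hx a l) hab,
          .of_orthogonal (he l) (hx i l) (hx b l) (by rw [(hsymm l).eq]; exact hab)⟩
      simp [this]
    · simp [hl])
  have hself : IsAligned (B k) (x i k) (x i k) := .inl ⟨1, by simp⟩
  simp only [add_zero] at h0
  simp only [Finset.sum_add_distrib, h0, hself, hcon, and_true, and_false, if_false,
    add_zero, Finset.sum_ite_eq', Finset.mem_univ, if_true] at h1
  have : ∀ a : ZMod 2, a + 1 ≠ a := by decide
  exact this _ h1

/-- The orthogonal basis `p e₀ + q e₁, -q e₀ + p e₁`. -/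
def rotatedFrame (e : ZMod 2 → Fin 2 → ℝ) (p q : ℝ) (s : ZMod 2) : Fin 2 → ℝ :=
  if s = 0 then p • e 0 + q • e 1 else -q • e 0 + p • e 1

theorem apply_rotatedFrame {B : LinearMap.BilinForm ℝ (Fin 2 → ℝ)} {e : ZMod 2 → Fin 2 → ℝ}
    (he : IsOrthonormalFrame B e) (p q : ℝ) (s t : ZMod 2) :
    B (rotatedFrame e p q s) (rotatedFrame e p q t) = if s = t then p ^ 2 + q ^ 2 else 0 := by
  have hz : ∀ b : ZMod 2, b = 0 ∨ b = 1 := by decide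
  rcases hz s with rfl | rfl <;> rcases hz t with rfl | rfl <;>
    simp only [rotatedFrame, he.apply_comb, one_ne_zero, zero_ne_one, if_true, if_false] <;> ring

theorem IsAligned.exists_smul_rotatedFrame {B : LinearMap.BilinForm ℝ (Fin 2 → ℝ)}
    {e : ZMod 2 → Fin 2 → ℝ} (he : IsOrthonormalFrame B e) {x y : Fin 2 → ℝ} (hx : x ≠ 0)
    (h : IsAligned B x y) :
    ∃ (s : ZMod 2) (c : ℝ), y = c • rotatedFrame e (B (e 0) x) (B (e 1) x) s := by
  rcases h with ⟨r, rfl⟩ | h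
  · exact ⟨0, r, by rw [rotatedFrame, if_pos rfl, ← he.expand x]⟩
  · obtain ⟨c, h0, h1⟩ := he.exists_eq_of_orthogonal hx h
    refine ⟨1, c, ?_⟩
    rw [he.expand y, h0, h1, rotatedFrame, if_neg (by decide)]
    module

end

/-! ### Coordinates and Zariski closure -/

namespace BinaryTensor

variable {d : ℕ}

theorem coords_tprod (x : Fin d → Fin 2 → ℝ) (w : Fin d → Fin 2) :
    coords (PiTensorProduct.tprod ℝ x) w = ∏ k, x k (w k) := by
  simp [coords, stdBasis]

theorem coords_sum_smul_tprod {ι : Type*} (s : Finset ι) (a : ι → ℝ)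
    (x : ι → Fin d → Fin 2 → ℝ) (w : Fin d → Fin 2) :
    coords (∑ i ∈ s, a i • PiTensorProduct.tprod ℝ (x i)) w = ∑ i ∈ s, a i * ∏ k, x i k (w k) := by
  simp only [← coords_tprod, coords, map_sum, map_smul, Finsupp.coe_finsetSum, Finset.sum_apply,
    Finsupp.coe_smul, Pi.smul_apply, smul_eq_mul]

theorem tprod_ne_zero {x : Fin d → Fin 2 → ℝ} (hx : ∀ k, x k ≠ 0) :
    PiTensorProduct.tprod ℝ x ≠ 0 := by
  choose w hw using fun k => Function.ne_iff.1 (hx k)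
  intro h
  have h1 := coords_tprod x w
  rw [h] at h1
  exact Finset.prod_ne_zero_iff.2 (fun k _ => hw k) (by rw [← h1]; simp [coords])

theorem ne_zero_of_tprod_ne_zero {x : Fin d → Fin 2 → ℝ} (h : PiTensorProduct.tprod ℝ x ≠ 0)
    (k : Fin d) : x k ≠ 0 :=
  fun hk => h ((PiTensorProduct.tprod ℝ).map_coord_zero k hk)

end BinaryTensor

theorem mem_tensorIdeal {d : ℕ} {S : Set (BinaryTensor d)} {f : MvPolynomial (Fin d → Fin 2) ℝ} :
    f ∈ tensorIdeal S ↔ ∀ T ∈ S, MvPolynomial.eval T.coords f = 0 := by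
  simp [tensorIdeal, MvPolynomial.mem_vanishingIdeal_iff, MvPolynomial.aeval_eq_eval]

theorem mem_zariskiClosure {d : ℕ} {S : Set (BinaryTensor d)} {T : BinaryTensor d} :
    T ∈ zariskiClosure S ↔ ∀ f ∈ tensorIdeal S, MvPolynomial.eval T.coords f = 0 := by
  simp [zariskiClosure, MvPolynomial.mem_zeroLocus_iff, MvPolynomial.aeval_eq_eval]

theorem subset_zariskiClosure {d : ℕ} (S : Set (BinaryTensor d)) : S ⊆ zariskiClosure S :=
  fun _ hT => mem_zariskiClosure.2 fun _ hf => mem_tensorIdeal.1 hf _ hT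

theorem tensorIdeal_zariskiClosure {d : ℕ} (S : Set (BinaryTensor d)) :
    tensorIdeal (zariskiClosure S) = tensorIdeal S :=
  le_antisymm (fun _ hf => mem_tensorIdeal.2 fun _ hT =>
      mem_tensorIdeal.1 hf _ (subset_zariskiClosure S hT))
    (fun _ hf => mem_tensorIdeal.2 fun _ hT => mem_zariskiClosure.1 hT _ hf)

theorem zariskiClosure_subset {d : ℕ} {S S' : Set (BinaryTensor d)} (h : S ⊆ zariskiClosure S') :
    zariskiClosure S ⊆ zariskiClosure S' := fun _ hT => mem_zariskiClosure.2 fun _ hf =>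
  mem_zariskiClosure.1 hT _ (mem_tensorIdeal.2 fun _ hT' => mem_zariskiClosure.1 (h hT') _ hf)

/-! ### Parametrization of the aligned tensors -/

noncomputable section

variable {d : ℕ}

/-- `∑ a_v h_1^{v_1} ⊗ ⋯ ⊗ h_d^{v_d}` over all even words `v`, where `h_k^0, h_k^1` is the frame `e k`
rotated by `(p k, q k)`. -/
def alignedTensor (e : Fin d → ZMod 2 → Fin 2 → ℝ) (p q : Fin d → ℝ) (a : EvenWord d → ℝ) :
    BinaryTensor d :=
  ∑ v, a v • PiTensorProduct.tprod ℝ fun k => rotatedFrame (e k) (p k) (q k) (v.1 k)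

/-- Up to rescaling the coefficients, only the slopes q/p of the frames matter. -/
theorem alignedTensor_eq_div (e : Fin d → ZMod 2 → Fin 2 → ℝ) {p : Fin d → ℝ} (hp : ∀ k, p k ≠ 0)
    (q : Fin d → ℝ) (a : EvenWord d → ℝ) :
    alignedTensor e p q a = alignedTensor e 1 (fun k => q k / p k) (fun v => a v * ∏ k, p k) := by
  refine Finset.sum_congr rfl fun v _ => ?_
  rw [mul_smul, ← MultilinearMap.map_smul_univ]
  congr 2
  funext k
  unfold rotatedFrame
  split_ifs
  · rw [Pi.one_apply, smul_add, smul_smul, smul_smul, mul_one, mul_div_cancel₀ _ (hp k)]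
  · rw [Pi.one_apply, smul_add, smul_smul, smul_smul, mul_one, mul_neg, mul_div_cancel₀ _ (hp k)]

/-- The polynomial version of `rotatedFrame e 1 t`. -/
def polyFrame {R : Type*} [CommRing R] [Algebra ℝ R] (e : ZMod 2 → Fin 2 → ℝ) (s : ZMod 2)
    (w : Fin 2) (t : R) : R :=
  if s = 0 then algebraMap ℝ R (e 0 w) + t * algebraMap ℝ R (e 1 w)
  else -t * algebraMap ℝ R (e 0 w) + algebraMap ℝ R (e 1 w)

open MvPolynomial

/-- The comorphism of the parametrization `(a, t) ↦ alignedTensor e 1 t a`. -/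
def alignedComorphism (e : Fin d → ZMod 2 → Fin 2 → ℝ) :
    MvPolynomial (Fin d → Fin 2) ℝ →ₐ[ℝ] MvPolynomial (EvenWord d ⊕ Fin d) ℝ :=
  aeval fun w => ∑ v : EvenWord d, X (Sum.inl v) *
    ∏ k, polyFrame (e k) (v.1 k) (w k) (X (Sum.inr k))

theorem eval_alignedComorphism (e : Fin d → ZMod 2 → Fin 2 → ℝ) (y : EvenWord d ⊕ Fin d → ℝ)
    (f : MvPolynomial (Fin d → Fin 2) ℝ) :
    eval y (alignedComorphism e f) =
      eval (alignedTensor e 1 (fun k => y (Sum.inr k)) fun v => y (Sum.inl v)).coords f := by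
  unfold alignedComorphism
  rw [← aeval_eq_eval, ← aeval_eq_eval]
  change ((aeval y).comp (aeval _)) f = _
  congr 1
  refine algHom_ext fun w => ?_
  rw [AlgHom.comp_apply, aeval_X, aeval_X, alignedTensor, BinaryTensor.coords_sum_smul_tprod,
    map_sum]
  refine Finset.sum_congr rfl fun v _ => ?_
  rw [map_mul, map_prod, aeval_X]
  congr 1
  refine Finset.prod_congr rfl fun k _ => ?_
  unfold polyFrame rotatedFrame
  split_ifs <;> simp

theorem continuous_eval_alignedTensor (e : Fin d → ZMod 2 → Fin 2 → ℝ) (q : Fin d → ℝ)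
    (a : EvenWord d → ℝ) (f : MvPolynomial (Fin d → Fin 2) ℝ) :
    Continuous fun p => eval (alignedTensor e p q a).coords f := by
  have h : Continuous fun p => (alignedTensor e p q a).coords := by
    refine continuous_pi fun w => ?_
    simp only [alignedTensor, BinaryTensor.coords_sum_smul_tprod]
    refine continuous_finsetSum _ fun v _ => continuous_const.mul
      (continuous_finsetProd _ fun k _ => ?_)
    unfold rotatedFrame
    split_ifs <;> simp only [Pi.add_apply, Pi.smul_apply, smul_eq_mul] <;> fun_prop
  exact (MvPolynomial.continuous_eval f).comp h

theorem eval_alignedTensor_eq_zero {e : Fin d → ZMod 2 → Fin 2 → ℝ}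
    {f : MvPolynomial (Fin d → Fin 2) ℝ} (hf : alignedComorphism e f = 0) (p q : Fin d → ℝ)
    (a : EvenWord d → ℝ) : eval (alignedTensor e p q a).coords f = 0 := by
  have hnz : ∀ p : Fin d → ℝ, (∀ k, p k ≠ 0) → eval (alignedTensor e p q a).coords f = 0 := by
    intro p hp
    rw [alignedTensor_eq_div e hp]
    have := eval_alignedComorphism e
      (Sum.elim (fun v => a v * ∏ k, p k) (fun k => q k / p k)) f
    simpa [hf] using this.symm
  -- The slope chart misses frames with some `p k = 0`. They are reached by continuity, since p + s
  -- has nonzero entries for all but finitely many s.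
  let F : ℝ → ℝ := fun s => eval (alignedTensor e (fun k => p k + s) q a).coords f
  have hF : Continuous F :=
    (continuous_eval_alignedTensor e q a f).comp (by fun_prop : Continuous fun s k => p k + s)
  have hd : Dense (Set.range fun k => -p k)ᶜ := (Set.finite_range _).countable.dense_compl ℝ
  have hz : F = fun _ => 0 := by
    refine hF.ext_on hd continuous_const fun s hs => hnz _ fun k hk => hs ⟨k, ?_⟩
    change -p k = s
    linarith
  simpa [F] using congrFun hz 0

variable {B : Fin d → LinearMap.BilinForm ℝ (Fin 2 → ℝ)} {e : Fin d → ZMod 2 → Fin 2 → ℝ}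

theorem IsAligned.collinear_or {B : LinearMap.BilinForm ℝ (Fin 2 → ℝ)} {x y : Fin 2 → ℝ}
    (h : IsAligned B x y) : Collinear ℝ ({0, x, y} : Set (Fin 2 → ℝ)) ∨ B x y = 0 := by
  refine h.imp_left ?_
  rintro ⟨r, rfl⟩
  rw [collinear_iff_of_mem (p₀ := 0) (by simp)]
  refine ⟨x, ?_⟩
  simp only [Set.mem_insert_iff, Set.mem_singleton_iff, vadd_eq_add, add_zero]
  rintro z (rfl | rfl | rfl)
  exacts [⟨0, by simp⟩, ⟨1, by simp⟩, ⟨r, rfl⟩]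

/-- A two-orthogonal family of maximal size with nonzero summands sums to an aligned tensor. -/
theorem exists_eq_alignedTensor {r : ℕ} (hr : r = 2 ^ (d - 1)) (hsymm : ∀ k, (B k).IsSymm)
    (he : ∀ k, IsOrthonormalFrame (B k) (e k)) {x : Fin r → Fin d → Fin 2 → ℝ}
    (hx : ∀ i k, x i k ≠ 0) (h : PairwiseTwoOrthogonal B x) :
    ∃ p q a, ∑ i, PiTensorProduct.tprod ℝ (x i) = alignedTensor e p q a := by
  classical
  have hr0 : 0 < r := by rw [hr]; positivity
  let i₀ : Fin r := ⟨0, hr0⟩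
  let p : Fin d → ℝ := fun k => B k (e k 0) (x i₀ k)
  let q : Fin d → ℝ := fun k => B k (e k 1) (x i₀ k)
  have hbase : ∀ k, x i₀ k = rotatedFrame (e k) (p k) (q k) 0 := fun k => (he k).expand _
  have hN : ∀ k, p k ^ 2 + q k ^ 2 ≠ 0 := by
    intro k h0
    apply hx i₀ k
    have hp : p k = 0 := by nlinarith [sq_nonneg (p k), sq_nonneg (q k)]
    have hq : q k = 0 := by nlinarith [sq_nonneg (p k), sq_nonneg (q k)]
    rw [hbase, hp, hq]
    simp [rotatedFrame]
  have hex : ∀ i k, ∃ (s : ZMod 2) (c : ℝ), x i k = c • rotatedFrame (e k) (p k) (q k) s := fun i k =>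
    (h.isAligned hr hsymm he hx k i₀ i).exists_smul_rotatedFrame (he k) (hx i₀ k)
  choose u c huc using hex
  have hc : ∀ i k, c i k ≠ 0 := by
    intro i k h0
    apply hx i k
    rw [huc, h0, zero_smul]
  have hsep : ∀ i j k, B k (x i k) (x j k) = 0 → u i k ≠ u j k := by
    intro i j k hij heq
    rw [huc i, huc j, heq] at hij
    simp [apply_rotatedFrame (he k), hc, hN] at hij
  have hu0 : ∀ k, u i₀ k = 0 := by
    intro k
    by_contra hne
    have h1 : B k (x i₀ k) (x i₀ k) = 0 := by
      nth_rewrite 1 [hbase k]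
      rw [huc i₀ k, map_smul, apply_rotatedFrame (he k), if_neg (Ne.symm hne), smul_zero]
    rw [hbase, apply_rotatedFrame (he k), if_pos rfl] at h1
    exact hN k h1
  have heven : ∀ i, ∑ k, u i k = 0 := by
    intro i
    rw [parity_eq_of_two_ne (by simp [hr]) u _ i i₀]
    · simp [hu0]
    · intro i j hij
      obtain ⟨k₁, k₂, hne, h₁, h₂⟩ := h i j hij
      exact ⟨k₁, k₂, hne, hsep _ _ _ h₁, hsep _ _ _ h₂⟩
  -- Summing over the fibre of each word avoids proving that i ↦ `u i` is a bijection onto the even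
  -- words.
  refine ⟨p, q, fun v => ∑ i with (⟨u i, heven i⟩ : EvenWord d) = v, ∏ k, c i k, ?_⟩
  unfold alignedTensor
  rw [← Finset.sum_fiberwise Finset.univ (fun i => (⟨u i, heven i⟩ : EvenWord d))]
  refine Finset.sum_congr rfl fun v _ => ?_
  rw [Finset.sum_smul]
  refine Finset.sum_congr rfl fun i hi => ?_
  have hv : (⟨u i, heven i⟩ : EvenWord d) = v := (Finset.mem_filter.1 hi).2
  rw [← hv, ← MultilinearMap.map_smul_univ]
  congr 1
  funext k
  exact huc i k

theorem PairwiseTwoOrthogonal.sum_mem_basisAlignedTensors {r : ℕ} (hr : r = 2 ^ (d - 1))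
    (hsymm : ∀ k, (B k).IsSymm) (he : ∀ k, IsOrthonormalFrame (B k) (e k))
    {x : Fin r → Fin d → Fin 2 → ℝ} (hx : ∀ i, PiTensorProduct.tprod ℝ (x i) ≠ 0)
    (h : PairwiseTwoOrthogonal B x) :
    ∑ i, PiTensorProduct.tprod ℝ (x i) ∈ basisAlignedTensors B r :=
  ⟨x, ⟨rfl, hx, h⟩, fun k i j => (h.isAligned hr hsymm he
    (fun i => BinaryTensor.ne_zero_of_tprod_ne_zero (hx i)) k i j).collinear_or⟩

theorem alignedTensor_mem_basisAlignedTensors (hd : 1 ≤ d) {r : ℕ} (hr : r = 2 ^ (d - 1))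
    (hsymm : ∀ k, (B k).IsSymm) (he : ∀ k, IsOrthonormalFrame (B k) (e k))
    (t : Fin d → ℝ) {a : EvenWord d → ℝ} (ha : ∀ v, a v ≠ 0) :
    alignedTensor e 1 t a ∈ basisAlignedTensors B r := by
  classical
  let ε : Fin r ≃ EvenWord d := Fintype.equivOfCardEq (by rw [card_evenWord hd, hr]; simp)
  let k₀ : Fin d := ⟨0, hd⟩
  -- The whole coefficient `a v` is absorbed into the first factor.
  let c : EvenWord d → Fin d → ℝ := fun v k => if k = k₀ then a v else 1
  let x : Fin r → Fin d → Fin 2 → ℝ := fun i k =>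
    c (ε i) k • rotatedFrame (e k) 1 (t k) ((ε i).1 k)
  have hc : ∀ v k, c v k ≠ 0 := by
    intro v k
    simp only [c]
    split_ifs
    exacts [ha v, one_ne_zero]
  have hsum : alignedTensor e 1 t a = ∑ i, PiTensorProduct.tprod ℝ (x i) := by
    unfold alignedTensor
    rw [← Equiv.sum_comp ε]
    refine Finset.sum_congr rfl fun i _ => ?_
    simp only [x]
    rw [MultilinearMap.map_smul_univ]
    simp [c]
  have hN : ∀ k, (1 : ℝ) ^ 2 + t k ^ 2 ≠ 0 := fun k => by positivity
  rw [hsum]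
  refine PairwiseTwoOrthogonal.sum_mem_basisAlignedTensors hr hsymm he (fun i => ?_) ?_
  · refine BinaryTensor.tprod_ne_zero fun k h0 => ?_
    have h1 := apply_rotatedFrame (he k) 1 (t k) ((ε i).1 k) ((ε i).1 k)
    rw [(smul_eq_zero.1 h0).resolve_left (hc _ _), if_pos rfl] at h1
    exact hN k (by rw [← h1]; simp)
  · intro i j hij
    obtain ⟨k₁, k₂, hne, h₁, h₂⟩ := EvenWord.exists_two_ne (ε.injective.ne hij)
    refine ⟨k₁, k₂, hne, ?_, ?_⟩
    · simp [x, apply_rotatedFrame (he k₁), h₁]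
    · simp [x, apply_rotatedFrame (he k₂), h₂]

theorem tensorIdeal_basisAlignedTensors (hd : 1 ≤ d) {r : ℕ} (hr : r = 2 ^ (d - 1))
    (hsymm : ∀ k, (B k).IsSymm) (he : ∀ k, IsOrthonormalFrame (B k) (e k)) :
    tensorIdeal (basisAlignedTensors B r) = RingHom.ker (alignedComorphism e) := by
  ext f
  rw [mem_tensorIdeal, RingHom.mem_ker]
  constructor
  · intro hf
    -- Parameters with some a_v = 0 need not give r nonzero summands; multiplying by all the a_v
    -- discards them, harmlessly in a domain.
    have hmul : alignedComorphism e f * ∏ v : EvenWord d, X (Sum.inl v) = 0 := by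
      refine MvPolynomial.funext fun y => ?_
      rw [map_mul, map_prod, map_zero, eval_alignedComorphism]
      by_cases hy : ∀ v : EvenWord d, y (Sum.inl v) ≠ 0
      · rw [hf _ (alignedTensor_mem_basisAlignedTensors hd hr hsymm he _ hy), zero_mul]
      · push Not at hy
        obtain ⟨v, hv⟩ := hy
        rw [Finset.prod_eq_zero (Finset.mem_univ v) (by simpa using hv), mul_zero]
    exact (mul_eq_zero.1 hmul).resolve_right
      (Finset.prod_ne_zero_iff.2 fun v _ => X_ne_zero _)
  · rintro hf T ⟨x, hx⟩
    obtain ⟨p, q, a, h⟩ := exists_eq_alignedTensor hr hsymm he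
      (fun i => BinaryTensor.ne_zero_of_tprod_ne_zero (hx.summand_ne_zero i)) hx.pairwise
    rw [hx.eq_sum, h]
    exact eval_alignedTensor_eq_zero hf p q a

end

/-! ### Dimension of the parametrized variety -/

noncomputable section

open MvPolynomial

variable {d : ℕ} {B : Fin d → LinearMap.BilinForm ℝ (Fin 2 → ℝ)} {e : Fin d → ZMod 2 → Fin 2 → ℝ}

/-- The linear form reading off the coordinate of a tensor along `e_1^{w_1} ⊗ ⋯ ⊗ e_d^{w_d}`. -/
def frameCoordinate (B : Fin d → LinearMap.BilinForm ℝ (Fin 2 → ℝ)) (e : Fin d → ZMod 2 → Fin 2 → ℝ)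
    (w : Fin d → ZMod 2) : MvPolynomial (Fin d → Fin 2) ℝ :=
  ∑ w' : Fin d → Fin 2, C (∏ k, B k (e k (w k)) (Pi.single (w' k) 1)) * X w'

/-- The coordinates of the rotated frame `h^0, h^1` with respect to the frame itself. -/
def rotationEntry {R : Type*} [CommRing R] (s r : ZMod 2) (t : R) : R :=
  if s = 0 then (if r = 0 then 1 else t) else (if r = 0 then -t else 1)

theorem sum_apply_single (B : LinearMap.BilinForm ℝ (Fin 2 → ℝ)) (x y : Fin 2 → ℝ) :
    ∑ w, B x (Pi.single w 1) * y w = B x y := by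
  conv_rhs => rw [← Finset.univ_sum_single y, map_sum]
  refine Finset.sum_congr rfl fun w _ => ?_
  rw [show (Pi.single w (y w) : Fin 2 → ℝ) = y w • Pi.single w 1 by
    rw [← Pi.single_smul, smul_eq_mul, mul_one], map_smul, smul_eq_mul, mul_comm]

theorem sum_mul_polyFrame {R : Type*} [CommRing R] [Algebra ℝ R]
    {B : LinearMap.BilinForm ℝ (Fin 2 → ℝ)} {e : ZMod 2 → Fin 2 → ℝ} (he : IsOrthonormalFrame B e)
    (s r : ZMod 2) (t : R) :
    ∑ w, algebraMap ℝ R (B (e r) (Pi.single w 1)) * polyFrame e s w t = rotationEntry s r t := by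
  have key : ∀ u : ZMod 2, ∑ w, algebraMap ℝ R (B (e r) (Pi.single w 1)) * algebraMap ℝ R (e u w) =
      if r = u then 1 else 0 := by
    intro u
    simp only [← map_mul, ← map_sum]
    rw [sum_apply_single, he.apply_eq]
    split_ifs <;> simp
  have hz : ∀ b : ZMod 2, b = 0 ∨ b = 1 := by decide
  unfold polyFrame rotationEntry
  rcases hz s with rfl | rfl
  · simp only [if_true, mul_add, Finset.sum_add_distrib, key, mul_left_comm _ t, ← Finset.mul_sum]
    rcases hz r with rfl | rfl <;> simp
  · simp only [one_ne_zero, if_false, mul_add, Finset.sum_add_distrib, key, mul_left_comm _ (-t),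
      ← Finset.mul_sum]
    rcases hz r with rfl | rfl <;> simp

/-- In frame coordinates the parametrization no longer involves `B` or `e`, so its Jacobian is
explicit. -/
theorem alignedComorphism_frameCoordinate (he : ∀ k, IsOrthonormalFrame (B k) (e k))
    (w : Fin d → ZMod 2) :
    alignedComorphism e (frameCoordinate B e w) =
      ∑ v : EvenWord d, X (Sum.inl v) * ∏ k, rotationEntry (v.1 k) (w k) (X (Sum.inr k)) := by
  classical
  simp only [frameCoordinate, alignedComorphism, map_sum, map_mul, aeval_X, Finset.mul_sum]
  rw [Finset.sum_comm]
  refine Finset.sum_congr rfl fun v _ => ?_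
  rw [Finset.prod_congr rfl fun k _ =>
    (sum_mul_polyFrame (he k) (v.1 k) (w k) (X (Sum.inr k) : MvPolynomial (EvenWord d ⊕ Fin d) ℝ)).symm]
  rw [Finset.prod_univ_sum, Finset.mul_sum, Fintype.piFinset_univ]
  refine Finset.sum_congr rfl fun w' _ => ?_
  rw [Finset.prod_mul_distrib, algHom_C, map_prod]
  ring

theorem pderiv_inl_prod_rotationEntry (u : EvenWord d) (v w : Fin d → ZMod 2) :
    pderiv (Sum.inl u)
      (∏ k, rotationEntry (v k) (w k) (X (Sum.inr k) : MvPolynomial (EvenWord d ⊕ Fin d) ℝ)) = 0 := by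
  refine Finset.prod_induction _ (fun f => pderiv (Sum.inl u) f = 0) (fun f g hf hg => ?_)
    pderiv_one fun k _ => ?_
  · rw [pderiv_mul, hf, hg, zero_mul, mul_zero, add_zero]
  · unfold rotationEntry
    split_ifs <;> simp

/-- The base point at which the Jacobian is evaluated. -/
def basePoint (d : ℕ) : EvenWord d ⊕ Fin d → ℝ :=
  Sum.elim (Pi.single ⟨0, by simp⟩ 1) 0

theorem basePoint_inl_zero : basePoint d (Sum.inl ⟨0, by simp⟩) = 1 := by
  rw [basePoint, Sum.elim_inl, Pi.single_eq_same]

theorem basePoint_inl_of_ne {v : EvenWord d} (hv : v ≠ ⟨0, by simp⟩) :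
    basePoint d (Sum.inl v) = 0 := by
  rw [basePoint, Sum.elim_inl, Pi.single_eq_of_ne hv]

theorem basePoint_inr (k : Fin d) : basePoint d (Sum.inr k) = 0 := rfl

/-- At slope 0 the rotated frame is the frame itself, so varying a_u moves along the basis tensor of
u. -/
theorem eval_pderiv_inl (u : EvenWord d) (w : Fin d → ZMod 2) :
    eval (basePoint d) (pderiv (Sum.inl u)
      (∑ v : EvenWord d, X (Sum.inl v) *
        ∏ k, rotationEntry (v.1 k) (w k) (X (Sum.inr k) : MvPolynomial (EvenWord d ⊕ Fin d) ℝ))) =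
      if u.1 = w then 1 else 0 := by
  classical
  simp only [map_sum, pderiv_mul, pderiv_inl_prod_rotationEntry, mul_zero, add_zero]
  rw [Finset.sum_eq_single u]
  · rw [pderiv_X_self, one_mul, map_prod]
    have hterm : ∀ k, eval (basePoint d) (rotationEntry (u.1 k) (w k) (X (Sum.inr k))) =
        if u.1 k = w k then 1 else 0 := by
      intro k
      have hz : ∀ b : ZMod 2, b = 0 ∨ b = 1 := by decide
      unfold rotationEntry
      rcases hz (u.1 k) with h | h <;> rcases hz (w k) with h' | h' <;>
        simp [h, h', basePoint_inr]
    simp only [hterm, Fintype.prod_ite_zero, Finset.prod_const_one, funext_iff]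
  · intro v _ hv
    rw [pderiv_X_of_ne (by simpa using hv)]
    simp
  · simp

/-- Only the zero word has a nonzero coefficient at the base point; tilting the l-th frame moves e₀
⊗ ⋯ ⊗ e₀ towards e₁ in factor l. -/
theorem eval_pderiv_inr (l j : Fin d) :
    eval (basePoint d) (pderiv (Sum.inr l)
      (∑ v : EvenWord d, X (Sum.inl v) * ∏ k, rotationEntry (v.1 k)
        ((Pi.single j 1 : Fin d → ZMod 2) k)
        (X (Sum.inr k) : MvPolynomial (EvenWord d ⊕ Fin d) ℝ))) =
      if l = j then 1 else 0 := by
  classical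
  simp only [map_sum, pderiv_mul]
  rw [Finset.sum_eq_single ⟨0, by simp⟩]
  · rw [Finset.prod_eq_single j]
    · rw [pderiv_X_of_ne (by simp), zero_mul, zero_add, map_mul, eval_X, basePoint_inl_zero, one_mul]
      by_cases hlj : l = j
      · simp [rotationEntry, hlj]
      · simp [rotationEntry, hlj, Ne.symm hlj]
    · intro k _ hk
      simp [rotationEntry, hk]
    · simp
  · intro v _ hv
    simp [basePoint_inl_of_ne hv]
  · simp

/-- Words with a single one are odd, so they are disjoint from the even words. The Jacobian is block
triangular with identity diagonal blocks. -/
theorem algebraicIndependent_frameCoordinate (he : ∀ k, IsOrthonormalFrame (B k) (e k)) :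
    AlgebraicIndependent ℝ (fun i : EvenWord d ⊕ Fin d =>
      alignedComorphism e (frameCoordinate B e (Sum.elim Subtype.val (fun j => Pi.single j 1) i))) := by
  classical
  refine algebraicIndependent_of_jacobian _ id (basePoint d) ?_
  simp only [alignedComorphism_frameCoordinate he, id]
  rw [← Matrix.fromBlocks_toBlocks (Matrix.of _)]
  have hodd : ∀ (u : EvenWord d) (j : Fin d), u.1 ≠ Pi.single j 1 := by
    intro u j h
    have := u.2
    rw [h, Finset.sum_pi_single'] at this
    simp at this
  have h11 : (Matrix.of fun i j : EvenWord d ⊕ Fin d => eval (basePoint d) (pderiv i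
      (∑ v : EvenWord d, X (Sum.inl v) * ∏ k, rotationEntry (v.1 k)
        (Sum.elim Subtype.val (fun j => Pi.single j 1) j k) (X (Sum.inr k))))).toBlocks₁₁ = 1 := by
    ext u v
    simp only [Matrix.toBlocks₁₁, Matrix.of_apply, Sum.elim_inl, eval_pderiv_inl, Matrix.one_apply,
      Subtype.ext_iff]
  have h12 : (Matrix.of fun i j : EvenWord d ⊕ Fin d => eval (basePoint d) (pderiv i
      (∑ v : EvenWord d, X (Sum.inl v) * ∏ k, rotationEntry (v.1 k)
        (Sum.elim Subtype.val (fun j => Pi.single j 1) j k) (X (Sum.inr k))))).toBlocks₁₂ = 0 := by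
    ext u j
    simp only [Matrix.toBlocks₁₂, Matrix.of_apply, Sum.elim_inr, eval_pderiv_inl, if_neg (hodd u j),
      Matrix.zero_apply]
  have h22 : (Matrix.of fun i j : EvenWord d ⊕ Fin d => eval (basePoint d) (pderiv i
      (∑ v : EvenWord d, X (Sum.inl v) * ∏ k, rotationEntry (v.1 k)
        (Sum.elim Subtype.val (fun j => Pi.single j 1) j k) (X (Sum.inr k))))).toBlocks₂₂ = 1 := by
    ext l j
    simp only [Matrix.toBlocks₂₂, Matrix.of_apply, Sum.elim_inr, eval_pderiv_inr, Matrix.one_apply]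
  rw [h11, h12, h22, Matrix.det_fromBlocks_zero₁₂]
  simp

/-- The quotient is the image of the comorphism. Its transcendence degree is bounded above by the
number of parameters and below by the independent frame coordinates. -/
theorem ringKrullDim_quotient_ker_alignedComorphism (hd : 1 ≤ d)
    (he : ∀ k, IsOrthonormalFrame (B k) (e k)) :
    ringKrullDim (MvPolynomial (Fin d → Fin 2) ℝ ⧸ RingHom.ker (alignedComorphism e)) =
      ((2 ^ (d - 1) + d : ℕ) : WithBot ℕ∞) := by
  let φ := alignedComorphism e
  have : Algebra.FiniteType ℝ φ.range :=
    Algebra.FiniteType.of_surjective φ.rangeRestrict φ.rangeRestrict_surjective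
  have hcard : Cardinal.mk (EvenWord d ⊕ Fin d) = ((2 ^ (d - 1) + d : ℕ) : Cardinal.{0}) := by
    rw [Cardinal.mk_fintype, Fintype.card_sum, card_evenWord hd, Fintype.card_fin]
  have hle : Algebra.trdeg ℝ φ.range ≤ (2 ^ (d - 1) + d : ℕ) := by
    have := trdeg_le_of_injective φ.range.val Subtype.val_injective
    rwa [trdeg_of_isDomain, Cardinal.lift_id, hcard] at this
  have hge : ((2 ^ (d - 1) + d : ℕ) : Cardinal.{0}) ≤ Algebra.trdeg ℝ φ.range := by
    have hind : AlgebraicIndependent ℝ (fun i : EvenWord d ⊕ Fin d => φ.rangeRestrict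
        (frameCoordinate B e (Sum.elim Subtype.val (fun j => Pi.single j 1) i))) :=
      AlgebraicIndependent.of_comp φ.range.val (algebraicIndependent_frameCoordinate he)
    rw [← hcard]
    exact hind.cardinalMk_le_trdeg
  rw [← ringKrullDim_eq_of_trdeg_eq (le_antisymm hle hge)]
  exact ringKrullDim_eq_of_ringEquiv (Ideal.quotientKerEquivRange φ).toRingEquiv

end

/-! ### Density of the aligned tensors -/

theorem PairwiseTwoOrthogonal.exists_shorter {d r : ℕ}
    {B : Fin d → LinearMap.BilinForm ℝ (Fin 2 → ℝ)} {x : Fin r → Fin d → Fin 2 → ℝ}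
    (h : PairwiseTwoOrthogonal B x) {i : Fin r} (hi : PiTensorProduct.tprod ℝ (x i) = 0) :
    ∃ y : Fin (r - 1) → Fin d → Fin 2 → ℝ, PairwiseTwoOrthogonal B y ∧
      ∑ j, PiTensorProduct.tprod ℝ (x j) = ∑ j, PiTensorProduct.tprod ℝ (y j) := by
  cases r with
  | zero => exact i.elim0
  | succ n =>
    exact ⟨fun j => x (i.succAbove j), fun a b hab => h _ _ (Fin.succAbove_right_injective.ne hab),
      by rw [Fin.sum_univ_succAbove _ i, hi, zero_add]; rfl⟩

theorem mainTheorem7 (d : ℕ) (hd : 2 ≤ d)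
    (B : Fin d → LinearMap.BilinForm ℝ (Fin 2 → ℝ))
    (hsymm : ∀ k, (B k).IsSymm)
    (hpos : ∀ k x, x ≠ 0 → 0 < B k x x)
    (hne : (twoOrthogonalVariety B (2 ^ (d - 1)) \
      twoOrthogonalVariety B (2 ^ (d - 1) - 1)).Nonempty) :
    zariskiClosure ((twoOrthogonalVariety B (2 ^ (d - 1)) \
        twoOrthogonalVariety B (2 ^ (d - 1) - 1)) ∩ basisAlignedTensors B (2 ^ (d - 1))) =
      zariskiClosure (twoOrthogonalVariety B (2 ^ (d - 1)) \
        twoOrthogonalVariety B (2 ^ (d - 1) - 1)) ∧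
    zariskiClosure (twoOrthogonalVariety B (2 ^ (d - 1)) \
        twoOrthogonalVariety B (2 ^ (d - 1) - 1)) =
      zariskiClosure (basisAlignedTensors B (2 ^ (d - 1))) ∧
    varietyDim (zariskiClosure (twoOrthogonalVariety B (2 ^ (d - 1)) \
        twoOrthogonalVariety B (2 ^ (d - 1) - 1))) = ((2 ^ (d - 1) + d : ℕ) : WithBot ℕ∞) := by
  choose e he using fun k => exists_isOrthonormalFrame (B k) (hsymm k) (hpos k)
  have hd1 : 1 ≤ d := by omega
  have hker := tensorIdeal_basisAlignedTensors hd1 rfl hsymm he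
  have hprime : (tensorIdeal (basisAlignedTensors B (2 ^ (d - 1)))).IsPrime :=
    hker ▸ RingHom.ker_isPrime _
  have hA : ∀ r, basisAlignedTensors B r ⊆ twoOrthogonalVariety B r := fun r T ⟨x, hx⟩ =>
    subset_zariskiClosure _ ⟨x, hx.pairwise, hx.eq_sum⟩
  set D := twoOrthogonalVariety B (2 ^ (d - 1)) \ twoOrthogonalVariety B (2 ^ (d - 1) - 1)
  set A := basisAlignedTensors B (2 ^ (d - 1))
  have hDA : D ⊆ zariskiClosure A := by
    rintro T ⟨hT, hT'⟩
    refine mem_zariskiClosure.2 fun f hf => ?_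
    rw [twoOrthogonalVariety, mem_zariskiClosure] at hT'
    push Not at hT'
    obtain ⟨g, hg, hgT⟩ := hT'
    -- `f` vanishes on the sums without zero summands and `g` on those with one, so `f * g` vanishes
    -- on all of W_r.
    have hfg := mem_zariskiClosure.1 hT (f * g) (mem_tensorIdeal.2 ?_)
    · rw [map_mul] at hfg
      exact (mul_eq_zero.1 hfg).resolve_right hgT
    · rintro _ ⟨x, hx, rfl⟩
      rw [map_mul]
      by_cases h0 : ∀ i, PiTensorProduct.tprod ℝ (x i) ≠ 0
      · rw [mem_tensorIdeal.1 hf _ (hx.sum_mem_basisAlignedTensors rfl hsymm he h0), zero_mul]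
      · push Not at h0
        obtain ⟨i, hi⟩ := h0
        rw [mem_tensorIdeal.1 hg _ (hx.exists_shorter hi), mul_zero]
  have hAD : A ⊆ zariskiClosure (D ∩ A) := by
    obtain ⟨T, hT⟩ := hne
    have hTA := hDA hT
    have hT' := hT.2
    rw [twoOrthogonalVariety, mem_zariskiClosure] at hT'
    push Not at hT'
    obtain ⟨g, hg, hgT⟩ := hT'
    have hgA : g ∉ tensorIdeal A := fun h => hgT (mem_zariskiClosure.1 hTA g h)
    intro S hS
    refine mem_zariskiClosure.2 fun f hf => ?_
    -- On `A`, `g` vanishes inside W_{r-1} and `f` outside it; since `g` is not in the prime ideal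
    -- of `A`, `f` is.
    refine mem_tensorIdeal.1 ((hprime.mem_or_mem (mem_tensorIdeal.2 fun S' hS' => ?_)).resolve_right
      hgA) S hS
    rw [map_mul]
    by_cases hW : S' ∈ twoOrthogonalVariety B (2 ^ (d - 1) - 1)
    · rw [mem_zariskiClosure.1 hW g hg, mul_zero]
    · rw [mem_tensorIdeal.1 hf S' ⟨⟨hA _ hS', hW⟩, hS'⟩, zero_mul]
  have h1 : zariskiClosure D ⊆ zariskiClosure A := zariskiClosure_subset hDA
  have h2 : zariskiClosure A ⊆ zariskiClosure (D ∩ A) := zariskiClosure_subset hAD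
  have h3 : zariskiClosure (D ∩ A) ⊆ zariskiClosure D :=
    zariskiClosure_subset (Set.inter_subset_left.trans (subset_zariskiClosure D))
  have hcl : zariskiClosure D = zariskiClosure A := h1.antisymm (h2.trans h3)
  refine ⟨h3.antisymm (h1.trans h2), hcl, ?_⟩
  rw [hcl, varietyDim, tensorIdeal_zariskiClosure, hker]
  exact ringKrullDim_quotient_ker_alignedComorphism hd1 he
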